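/- Let $(V,\mathbf g)$ be a finite-dimensional Lorentzian manifold ($V$ smooth and Hausdorff, $\mathbf g$ of class $C^1$, e.g. smooth, with signature $(+,-,\dots,-)$) that is causally oriented by a continuous timelike vector field. For $x\in V$ let $\Theta^+_x\subset T_xV$ be the set of (non-zero) future-directed causal vectors and $\partial\Theta^+_x\subset\Theta^+_x$ the set of future-directed null vectors. A rank-2 covariant tensor field $\mathbf T$ is a *future tensor* if $\mathbf T|_x(\vec u,\vec v)\ge 0$ for all $x$ and all $\vec u,\vec v\in\Theta^+_x$; its set of principal null directions at $x$ is $\mu(\mathbf T|_x)=\{\vec k\in\partial\Theta^+_x:\ \mathbf T|_x(\vec k,\vec k)=0\}$. A *causal symmetry* is a diffeomorphism $\varphi$ of $V$ whose push-forward $\varphi'$ maps $\Theta^+_x$ into $\Theta^+_{\varphi(x)}$ for every $x$. Let $\vec\xi$ be a smooth complete vector field, i.e. the generator of a smooth global one-parameter group of diffeomorphisms $\{\varphi_s\}_{s\in\mathbb R}$ of $V$. The field $\vec\xi$ is *causal preserving* if $\varphi_s$ is a causal symmetry for all $s\ge 0$; its *canonical null directions* at $x$ are $\mu_{\vec\xi}|_x=\{\vec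 k\in\partial\Theta^+_x:\ \varphi_s'\vec k \text{ is null for all } s\in\mathbb R\}$. **Theorem.** Assume that there is a function $\alpha:V\to\mathbb R$ such that $\mathbf R=\pounds_{\vec\xi}\,\mathbf g-\alpha\,\mathbf g$ is a future tensor, and that the number $m=\dim\operatorname{Span}\mu(\mathbf R|_x)$ of linearly independent principal null directions of $\mathbf R$ is the same for all $x\in V$. 1. If $\mu(\mathbf R|_x)=\emptyset$ for all $x$, then $\vec\xi$ is causal preserving, and $\mu_{\vec\xi}|_x=\mu(\varphi_s^*\mathbf g|_x)=\emptyset$ for all $x\in V$ and all $s>0$. 2. Suppose that $\mu(\mathbf R|_x)\neq\emptyset$ for some (hence every) $x$, and let $\mathbf\Omega$ be an $m$-form of class $C^1$ on $V$ that at each point $x$ is a non-zero multiple of $\mathbf k_1\wedge\dots\wedge\mathbf k_m$, where $\mathbf k_i=\mathbf g(\vec k_i,\cdot)$ and $\vec k_1,\dots,\vec k_m\in\mu(\mathbf R|_x)$ are linearly independent. If $\pounds_{\vec\xi}\,\mathbf\Omega=\psi\,\mathbf\Omega$ for some function $\psi:V\to\mathbb R$, then $\vec\xi$ is causal preserving,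 and $\mu_{\vec\xi}|_x=\mu(\varphi_s^*\mathbf g|_x)=\mu(\mathbf R|_x)$ for all $x\in V$ and all $s>0$. -/

import Mathlib

open Set Bundle
open scoped Manifold ContDiff Topology

noncomputable section

namespace CausalSymm

variable {E : Type*} [NormedAddCommGroup E] [NormedSpace ℝ E]
  {M : Type*} [TopologicalSpace M] [ChartedSpace E M]

/-! ### Lorentzian metrics, signature `(+,-,…,-)`, and causal orientation -/

variable (E M) in
/-- A Lorentzian metric of class `C^1` with signature `(+,-,…,-)`.  The signature condition says
that every tangent space contains a vector `u` with `g(u,u) > 0` such that `g` is negative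
definite on the `g`-orthogonal complement of `u`. -/
structure LorentzMetric [IsManifold 𝓘(ℝ, E) ∞ M] where
  /-- the scalar product on each tangent space -/
  val (x : M) : TangentSpace 𝓘(ℝ, E) x →L[ℝ] TangentSpace 𝓘(ℝ, E) x →L[ℝ] ℝ
  symm (x : M) (u v : TangentSpace 𝓘(ℝ, E) x) : val x u v = val x v u
  signature (x : M) : ∃ u : TangentSpace 𝓘(ℝ, E) x, 0 < val x u u ∧
    ∀ v : TangentSpace 𝓘(ℝ, E) x, val x u v = 0 → v ≠ 0 → val x v v < 0
  contMDiff : ContMDiff 𝓘(ℝ, E) (𝓘(ℝ, E).prod 𝓘(ℝ, E →L[ℝ] E →L[ℝ] ℝ)) 1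
    (fun x ↦ TotalSpace.mk' (E →L[ℝ] E →L[ℝ] ℝ)
      (E := fun x : M ↦ TangentSpace 𝓘(ℝ, E) x →L[ℝ] TangentSpace 𝓘(ℝ, E) x →L[ℝ] ℝ) x (val x))

variable [IsManifold 𝓘(ℝ, E) ∞ M]

/-- A causal orientation: a continuous everywhere timelike vector field, declared to be
future directed. -/
structure CausalOrientation (g : LorentzMetric E M) where
  /-- the orienting vector field -/
  field (x : M) : TangentSpace 𝓘(ℝ, E) x
  timelike (x : M) : 0 < g.val x (field x) (field x)
  continuous : Continuous (fun x ↦ (TotalSpace.mk' E x (field x) : TangentBundle 𝓘(ℝ, E) M))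

/-- `Θ⁺_x`: the future-directed causal vectors at `x` (the zero vector is excluded). -/
def futureCausal (g : LorentzMetric E M) (τ : CausalOrientation g) (x : M) :
    Set (TangentSpace 𝓘(ℝ, E) x) :=
  {u | 0 ≤ g.val x u u ∧ 0 < g.val x (τ.field x) u}

/-- `∂Θ⁺_x`: the future-directed null vectors at `x` (the zero vector is excluded). -/
def futureNull (g : LorentzMetric E M) (τ : CausalOrientation g) (x : M) :
    Set (TangentSpace 𝓘(ℝ, E) x) :=
  {k | g.val x k k = 0 ∧ 0 < g.val x (τ.field x) k}

/-! ### Future tensors of rank two and their principal null directions -/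

/-- A family of bilinear forms `T` on the tangent spaces is a future tensor (an element of
`DP⁺_2`) if it is nonnegative on all pairs of future-directed causal vectors. -/
def IsFutureTensor (g : LorentzMetric E M) (τ : CausalOrientation g)
    (T : ∀ x : M, TangentSpace 𝓘(ℝ, E) x → TangentSpace 𝓘(ℝ, E) x → ℝ) : Prop :=
  ∀ x, ∀ u ∈ futureCausal g τ x, ∀ v ∈ futureCausal g τ x, 0 ≤ T x u v

/-- `μ(T|_x)`: the principal null directions of `T` at `x`, that is, the future-directed null
vectors `k` with `T(k,k) = 0`. -/
def principalNull (g : LorentzMetric E M) (τ : CausalOrientation g)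
    (T : ∀ x : M, TangentSpace 𝓘(ℝ, E) x → TangentSpace 𝓘(ℝ, E) x → ℝ) (x : M) :
    Set (TangentSpace 𝓘(ℝ, E) x) :=
  {k | k ∈ futureNull g τ x ∧ T x k k = 0}

/-! ### Complete vector fields and Lie derivatives -/

/-- `φ` is a global smooth one-parameter group of diffeomorphisms of `M`, that is, a smooth action
of `ℝ` on `M`, with infinitesimal generator `ξ`, that is, `ξ(x) = d/ds φ_s(x)` at `s = 0`.
A vector field is complete if it generates such a group. -/
structure IsGlobalFlow (ξ : ∀ x : M, TangentSpace 𝓘(ℝ, E) x) (φ : ℝ → M → M) : Prop where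
  contMDiff : ContMDiff (𝓘(ℝ, ℝ).prod 𝓘(ℝ, E)) 𝓘(ℝ, E) ∞ (fun p : ℝ × M ↦ φ p.1 p.2)
  map_zero (x : M) : φ 0 x = x
  map_add (s t : ℝ) (x : M) : φ (s + t) x = φ s (φ t x)
  generator (x : M) : HasMFDerivAt 𝓘(ℝ, ℝ) 𝓘(ℝ, E) (fun s : ℝ ↦ φ s x) 0
    ((1 : ℝ →L[ℝ] ℝ).smulRight (ξ (φ 0 x)))

/-- The push-forward `φ' : T_x M → T_{φ(x)} M` of tangent vectors. -/
def push (φ : M → M) (x : M) :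
    TangentSpace 𝓘(ℝ, E) x →L[ℝ] TangentSpace 𝓘(ℝ, E) (φ x) :=
  mfderiv 𝓘(ℝ, E) 𝓘(ℝ, E) φ x

/-- The pull-back `φ^* g` of the metric. -/
def pullMetric (g : LorentzMetric E M) (φ : M → M) (x : M) (u v : TangentSpace 𝓘(ℝ, E) x) : ℝ :=
  g.val (φ x) (push φ x u) (push φ x v)

/-- The Lie derivative of the metric along the generator of the flow `φ`,
`(£_ξ g)_x(u,v) = d/ds (φ_s^* g)_x(u,v)` at `s = 0`. -/
def lieMetric (g : LorentzMetric E M) (φ : ℝ → M → M) (x : M)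
    (u v : TangentSpace 𝓘(ℝ, E) x) : ℝ :=
  deriv (fun s : ℝ ↦ pullMetric g (φ s) x u v) 0

variable (E M) in
/-- Differential `m`-forms of class `C^1`. -/
structure DiffForm (m : ℕ) where
  /-- the alternating form on each tangent space -/
  val (x : M) : TangentSpace 𝓘(ℝ, E) x [⋀^Fin m]→L[ℝ] ℝ
  contMDiff : ContMDiff 𝓘(ℝ, E) (𝓘(ℝ, E).prod 𝓘(ℝ, E [⋀^Fin m]→L[ℝ] ℝ)) 1
    (fun x ↦ TotalSpace.mk' (E [⋀^Fin m]→L[ℝ] ℝ)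
      (E := fun x : M ↦ TangentSpace 𝓘(ℝ, E) x [⋀^Fin m]→L[ℝ] Bundle.Trivial M ℝ x) x (val x))

/-- The pull-back `φ^* Ω` of a form. -/
def pullForm {m : ℕ} (Ω : DiffForm E M m) (φ : M → M) (x : M)
    (v : Fin m → TangentSpace 𝓘(ℝ, E) x) : ℝ :=
  Ω.val (φ x) (fun i ↦ push φ x (v i))

/-- The Lie derivative of a form along the generator of the flow `φ`,
`(£_ξ Ω)_x(v₁,…,v_m) = d/ds (φ_s^* Ω)_x(v₁,…,v_m)` at `s = 0`. -/
def lieForm {m : ℕ} (Ω : DiffForm E M m) (φ : ℝ → M → M) (x : M)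
    (v : Fin m → TangentSpace 𝓘(ℝ, E) x) : ℝ :=
  deriv (fun s : ℝ ↦ pullForm Ω (φ s) x v) 0

/-- `Ω` is a non-zero `m`-form of maximum degree on `Span N`, where `N x` is a set of vectors at
`x` whose span has dimension `m`: at every point `x` it is a non-zero multiple of
`k₁ ∧ … ∧ k_m`, where the `k_i` are the one-forms `g(k_i, ·)` associated to `m` linearly
independent elements of `N x`.  The value of this wedge product on `(v₁,…,v_m)` is the
determinant of the matrix `g(k_i, v_j)`. -/
def IsTopFormOn (g : LorentzMetric E M) (N : ∀ x : M, Set (TangentSpace 𝓘(ℝ, E) x)) {m : ℕ}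
    (Ω : DiffForm E M m) : Prop :=
  ∀ x, ∃ (c : ℝ) (k : Fin m → TangentSpace 𝓘(ℝ, E) x),
    c ≠ 0 ∧ (∀ i, k i ∈ N x) ∧ LinearIndependent ℝ k ∧
    ∀ v : Fin m → TangentSpace 𝓘(ℝ, E) x,
      Ω.val x v = c * (Matrix.of fun i j ↦ g.val x (k i) (v j)).det

/-! ### Causal symmetries and causal-preserving vector fields -/

/-- Causal symmetries: the diffeomorphisms of `M` whose push-forward maps future-directed causal
vectors to future-directed causal vectors. -/
def IsCausalSymmetry (g : LorentzMetric E M) (τ : CausalOrientation g) (φ : M → M) : Prop :=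
  (∃ Φ : Diffeomorph 𝓘(ℝ, E) 𝓘(ℝ, E) M M ∞, ⇑Φ = φ) ∧
  ∀ x, ∀ u ∈ futureCausal g τ x, push φ x u ∈ futureCausal g τ (φ x)

/-- A (complete) vector field is causal preserving if all members `φ_s`, `s ≥ 0`, of the
one-parameter group it generates are causal symmetries. -/
def IsCausalPreserving (g : LorentzMetric E M) (τ : CausalOrientation g)
    (ξ : ∀ x : M, TangentSpace 𝓘(ℝ, E) x) : Prop :=
  ∃ φ : ℝ → M → M, IsGlobalFlow ξ φ ∧ ∀ s : ℝ, 0 ≤ s → IsCausalSymmetry g τ (φ s)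

/-- `μ_ξ|_x`: the canonical null directions of the flow `φ` of `ξ`, that is, the future-directed
null vectors at `x` that remain null under the push-forward by every `φ_s`, `s ∈ ℝ`. -/
def canonicalNull (g : LorentzMetric E M) (τ : CausalOrientation g) (φ : ℝ → M → M) (x : M) :
    Set (TangentSpace 𝓘(ℝ, E) x) :=
  {k | k ∈ futureNull g τ x ∧ ∀ s : ℝ, pullMetric g (φ s) x k k = 0}

end CausalSymm

end

/-! Fix `x` and pull everything back along the orbit: `G s = φ_s^* g` is a curve of Lorentzian
products on `T_x M` with derivative `D s = φ_s^* £_ξ g`. On null vectors `α g` vanishes, so the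
future-tensor condition gives `D s k k ≥ 0` for every `G s`-null `k`. By `cone_quotient_le`, `D/G`
on spacelike vectors is then at most `D/G` on timelike ones. Comparing `G s u u` with `G s e e`, `e`
timelike, shows that causal vectors stay causal and timelike ones timelike (`nonneg_of_le`,
`pos_of_le`); the time orientation cannot flip, by continuity. A vector null at times `0` and `s >
0` is therefore null in between, so `D 0 k k = 0`. This settles the first claim and one inclusion of
the second.

For the converse, `£_ξ Ω = ψ Ω` makes the kernel `K` of `φ_s^* Ω` independent of `s`, and `K` is the
`G s`-orthogonal complement of the principal null directions at time `s`. Given such a direction `k`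
at time `a`, put `θ = G a k` and let `w s` be the `G s`-dual of `θ`. Since `θ` kills `K`, `w s` lies
in the span of the principal directions, where `D s = c s • G s`. Hence `q = θ (w s)` solves `q' =
-c q` with `q a = 0`, so every `w s` is null. Monotonicity of the cones forces `k` to be
proportional to `w s`, hence null at time `s` (`null_of_orthogonal_const`). -/

noncomputable section

namespace CausalSymm

/-! ### Lorentzian bilinear forms and forms nonnegative on the null cone. -/

section BilinearForms

variable {V : Type*} [AddCommGroup V] [Module ℝ V]

/-- Symmetric bilinear forms of signature `(+,-,…,-)`. -/
structure IsLorentzian (B : LinearMap.BilinForm ℝ V) : Prop where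
  symm (u v : V) : B u v = B v u
  signature : ∃ u, 0 < B u u ∧ ∀ v, B u v = 0 → v ≠ 0 → B v v < 0

theorem bilin_add_smul_self {B : LinearMap.BilinForm ℝ V} (hB : ∀ u v, B u v = B v u) (u v : V)
    (t : ℝ) : B (u + t • v) (u + t • v) = B u u + 2 * t * B u v + t ^ 2 * B v v := by
  simp only [map_add, map_smul, LinearMap.add_apply, LinearMap.smul_apply, smul_eq_mul]
  rw [hB v u]; ring

namespace IsLorentzian

variable {B : LinearMap.BilinForm ℝ V}

/-- Any timelike `t` can replace the vector of the signature condition: otherwise the form is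
nonnegative on the plane of `t` and `v`, and this plane meets the negative definite hyperplane
`e^⊥`. -/
theorem neg_of_orthogonal (hB : IsLorentzian B) {t v : V} (ht : 0 < B t t) (htv : B t v = 0)
    (hv : v ≠ 0) : B v v < 0 := by
  obtain ⟨e, he, hneg⟩ := hB.signature
  by_contra! hvv
  have ht0 : t ≠ 0 := by rintro rfl; simp at ht
  have hte : B e t ≠ 0 := fun h ↦ absurd (hneg t h ht0) ht.not_gt
  set x := B e v • t - B e t • v with hx
  have hex : B e x = 0 := by simp [hx]; ring
  have hxx : B x x = B e v ^ 2 * B t t + B e t ^ 2 * B v v := by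
    simp only [hx, map_sub, map_smul, LinearMap.sub_apply, LinearMap.smul_apply, smul_eq_mul]
    rw [hB.symm v t, htv]; ring
  have hx0 : x ≠ 0 := by
    intro h0
    have h1 : B t x = B e v * B t t := by simp [hx, htv]
    rw [h0, map_zero] at h1
    have h2 : B e v = 0 := by
      rcases mul_eq_zero.1 h1.symm with h | h
      · exact h
      · exact absurd h ht.ne'
    rw [hx, h2, zero_smul, zero_sub, neg_eq_zero] at h0
    exact (smul_ne_zero hte hv) h0
  have := hneg x hex hx0
  rw [hxx] at this
  have : 0 ≤ B e v ^ 2 * B t t + B e t ^ 2 * B v v := by positivity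
  linarith

theorem eq_zero_of_forall (hB : IsLorentzian B) {u : V} (h : ∀ v, B u v = 0) : u = 0 := by
  obtain ⟨e, he, hneg⟩ := hB.signature
  by_contra hu
  exact absurd (h u) (hneg u (by rw [hB.symm, h]) hu).ne

theorem ne_zero_of_timelike (hB : IsLorentzian B) {t u : V} (ht : 0 < B t t) (hu : u ≠ 0)
    (huu : 0 ≤ B u u) : B t u ≠ 0 :=
  fun h ↦ absurd (hB.neg_of_orthogonal ht h hu) huu.not_gt

/-- Subtracting from `n` the multiple of `k` that makes it orthogonal to `e` does not change `B n
n`. -/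
theorem orthogonal_null (hB : IsLorentzian B) {k n : V} (hk : B k k = 0) (hk0 : k ≠ 0)
    (hkn : B k n = 0) : B n n ≤ 0 ∧ (B n n = 0 → ∃ a : ℝ, n = a • k) := by
  obtain ⟨e, he, -⟩ := hB.signature
  have hek := hB.ne_zero_of_timelike he hk0 hk.ge
  set a := B e n / B e k with ha
  have h1 : B e (n - a • k) = 0 := by simp [ha, hek]
  have h2 : B (n - a • k) (n - a • k) = B n n := by
    simp only [map_sub, map_smul, LinearMap.sub_apply, LinearMap.smul_apply, smul_eq_mul]
    rw [hB.symm n k, hkn, hk]; ring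
  by_cases h3 : n - a • k = 0
  · rw [h3] at h2
    exact ⟨by simp [← h2], fun _ ↦ ⟨a, sub_eq_zero.1 h3⟩⟩
  · have h4 := hB.neg_of_orthogonal he h1 h3
    rw [h2] at h4
    exact ⟨h4.le, fun h ↦ absurd h h4.ne⟩

theorem exists_neg_of_null (hB : IsLorentzian B) {k : V} (hk : B k k = 0) (hk0 : k ≠ 0) :
    ∃ v, B v v < 0 := by
  obtain ⟨e, he, -⟩ := hB.signature
  have hek := hB.ne_zero_of_timelike he hk0 hk.ge
  set v := e + (-(B e e) / B e k) • k with hv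
  refine ⟨v, ?_⟩
  rw [hv, bilin_add_smul_self hB.symm, hk]
  have : B e e + 2 * (-(B e e) / B e k) * B e k + (-(B e e) / B e k) ^ 2 * 0 = - B e e := by
    field_simp; ring
  rw [this]; linarith

end IsLorentzian

variable {B D : LinearMap.BilinForm ℝ V}

/-- If `D` is nonnegative on the null vectors of `B`, the quotient `D(u,u)/B(u,u)` for spacelike
`u` is at most the one for timelike `e`. -/
theorem cone_quotient_le (hB : ∀ u v, B u v = B v u) (hD : ∀ u v, D u v = D v u)
    (hnull : ∀ k, B k k = 0 → 0 ≤ D k k) {e u : V} (he : 0 < B e e) (hu : B u u < 0) :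
    D e e * B u u ≤ D u u * B e e := by
  set a := B u u
  set b := B e u
  set c := B e e
  have hdisc : 0 < b ^ 2 - a * c := by nlinarith
  set r := √(b ^ 2 - a * c) with hr
  have hr0 : 0 < r := Real.sqrt_pos.2 hdisc
  have hr2 : r ^ 2 = b ^ 2 - a * c := Real.sq_sqrt hdisc.le
  have ha : a ≠ 0 := hu.ne
  -- The line `e + t u` meets the null cone at two parameters, of opposite signs because `c / a <
  -- 0`.
  have key (t : ℝ) (ht : a * t ^ 2 + 2 * b * t + c = 0) :
      0 ≤ D e e + 2 * t * D e u + t ^ 2 * D u u := by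
    rw [← bilin_add_smul_self hD]
    apply hnull
    rw [bilin_add_smul_self hB, ← ht]; ring
  set t₁ := (-b + r) / a with ht₁
  set t₂ := (-b - r) / a with ht₂
  have e₁ : a * t₁ = -b + r := by rw [ht₁]; field_simp
  have e₂ : a * t₂ = -b - r := by rw [ht₂]; field_simp
  have k₁ := key t₁ (by
    apply mul_left_cancel₀ ha
    linear_combination (a * t₁ + r + b) * e₁ + hr2)
  have k₂ := key t₂ (by
    apply mul_left_cancel₀ ha
    linear_combination (a * t₂ - r + b) * e₂ + hr2)
  have hprod : a * (t₁ * t₂) = c := by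
    apply mul_left_cancel₀ ha
    linear_combination (a * t₂) * e₁ + (-b + r) * e₂ - hr2
  have hlt : t₁ < t₂ := by
    have : a * (t₂ - t₁) = - (2 * r) := by linear_combination e₂ - e₁
    nlinarith
  have hneg : t₁ * t₂ < 0 := by
    by_contra! h; nlinarith
  have hs1 : t₁ < 0 := by by_contra! h; nlinarith
  have hs2 : 0 < t₂ := by by_contra! h; nlinarith
  -- The weights `t₂` and `-t₁` cancel the mixed term `D e u`.
  have hsum : 0 ≤ (t₂ - t₁) * (D e e - t₁ * t₂ * D u u) := by
    have := add_nonneg (mul_nonneg hs2.le k₁) (mul_nonneg (neg_nonneg.2 hs1.le) k₂)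
    nlinarith
  have h3 : 0 ≤ D e e - t₁ * t₂ * D u u := by
    by_contra! h
    nlinarith
  have h4 : a * (D e e - t₁ * t₂ * D u u) ≤ 0 := mul_nonpos_of_nonpos_of_nonneg hu.le h3
  have h5 : a * (D e e - t₁ * t₂ * D u u) = D e e * a - D u u * c := by
    rw [← hprod]; ring
  linarith

theorem exists_forall_mul_le (hB : IsLorentzian B) (hD : ∀ u v, D u v = D v u)
    (hnull : ∀ k, B k k = 0 → 0 ≤ D k k) {u₀ : V} (hu₀ : B u₀ u₀ < 0) :
    ∃ c : ℝ, ∀ v, c * B v v ≤ D v v := by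
  obtain ⟨e, he, -⟩ := hB.signature
  set S := (fun u ↦ D u u / B u u) '' {u | B u u < 0} with hS
  -- Spacelike quotients lie below timelike ones, so their supremum separates the two; `u₀` makes
  -- the set nonempty.
  have hle {e u : V} (he : 0 < B e e) (hu : B u u < 0) : D u u / B u u ≤ D e e / B e e := by
    rw [div_le_iff_of_neg hu, div_mul_eq_mul_div, div_le_iff₀ he]
    exact cone_quotient_le hB.symm hD hnull he hu
  have hbdd : BddAbove S := ⟨D e e / B e e, by rintro _ ⟨u, hu, rfl⟩; exact hle he hu⟩
  refine ⟨sSup S, fun v ↦ ?_⟩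
  rcases lt_trichotomy (B v v) 0 with hv | hv | hv
  · rw [← div_le_iff_of_neg hv]
    exact le_csSup hbdd ⟨v, hv, rfl⟩
  · simpa [hv] using hnull v hv
  · rw [← le_div_iff₀ hv]
    refine csSup_le ⟨_, u₀, hu₀, rfl⟩ ?_
    rintro _ ⟨u, hu, rfl⟩
    exact hle hv hu

/-- `D - c B` is positive semidefinite, so its isotropic vector `k` lies in its radical. -/
theorem apply_eq_mul_of_null (hB : ∀ u v, B u v = B v u) (hD : ∀ u v, D u v = D v u) {c : ℝ}
    (hc : ∀ v, c * B v v ≤ D v v) {k : V} (hk : B k k = 0) (hDk : D k k = 0) (v : V) :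
    D k v = c * B k v := by
  have h (t : ℝ) : 0 ≤ (D v v - c * B v v) * (1 : ℝ) + 2 * t * (D k v - c * B k v) := by
    have := hc (v + t • k)
    rw [bilin_add_smul_self hB, bilin_add_smul_self hD, hk, hDk, hB v k, hD v k] at this
    linarith
  by_contra hne
  have hne' : D k v - c * B k v ≠ 0 := sub_ne_zero.2 hne
  -- This `t` makes the right-hand side of `h` equal to `-1`.
  have := h (-(D v v - c * B v v + 1) / (2 * (D k v - c * B k v)))
  have h2 : 2 * (-(D v v - c * B v v + 1) / (2 * (D k v - c * B k v))) * (D k v - c * B k v)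
    = -(D v v - c * B v v + 1) := by field_simp
  rw [h2] at this
  linarith

theorem apply_eq_mul_of_mem_span (hB : ∀ u v, B u v = B v u) (hD : ∀ u v, D u v = D v u) {c : ℝ}
    (hc : ∀ v, c * B v v ≤ D v v) {w : V}
    (hw : w ∈ Submodule.span ℝ {k | B k k = 0 ∧ D k k = 0}) (v : V) :
    D w v = c * B w v := by
  induction hw using Submodule.span_induction with
  | mem k hk => exact apply_eq_mul_of_null hB hD hc hk.1 hk.2 v
  | zero => simp
  | add x y _ _ hx hy => simp [hx, hy, mul_add]
  | smul a x _ hx => simp [hx]; ring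

end BilinearForms

/-! ### Dual families and kernels of decomposable forms. -/

section LinearAlgebra

variable {V : Type*} [AddCommGroup V] [Module ℝ V] {ι : Type*} [Fintype ι] [DecidableEq ι]

/-- Linearly independent linear forms have a dual family of vectors. -/
theorem exists_dual_family {f : ι → V →ₗ[ℝ] ℝ} (hf : LinearIndependent ℝ f) :
    ∃ y : ι → V, ∀ i j, f i (y j) = if i = j then 1 else 0 := by
  -- If the joint map were not onto, a nonzero functional vanishing on its range would be a linear
  -- relation among the `f i`.
  have hsurj : LinearMap.range (LinearMap.pi f) = ⊤ := by
    by_contra hne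
    obtain ⟨l, hl0, hl⟩ := Submodule.exists_le_ker_of_lt_top _ (lt_top_iff_ne_top.2 hne)
    have hlsum (a : ι → ℝ) : l a = ∑ i, a i * l (Pi.single i 1) := by
      conv_lhs => rw [← Finset.univ_sum_single a, map_sum]
      refine Finset.sum_congr rfl fun i _ ↦ ?_
      rw [← smul_eq_mul, ← map_smul, ← Pi.single_smul, smul_eq_mul, mul_one]
    have hsum : ∑ i, l (Pi.single i 1) • f i = 0 := by
      ext v
      have h1 : l (LinearMap.pi f v) = 0 := hl ⟨v, rfl⟩
      rw [hlsum] at h1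
      simpa [mul_comm] using h1
    have h0 := Fintype.linearIndependent_iff.1 hf _ hsum
    exact hl0 (LinearMap.ext fun a ↦ by rw [hlsum]; simp [h0])
  choose y hy using fun j ↦ LinearMap.range_eq_top.1 hsurj (Pi.single j 1)
  refine ⟨y, fun i j ↦ ?_⟩
  have := congrFun (hy j) i
  rw [LinearMap.pi_apply] at this
  rw [this, Pi.single_apply]

theorem exists_det_ne_zero {f : ι → V →ₗ[ℝ] ℝ} (hf : LinearIndependent ℝ f) :
    ∃ y : ι → V, (Matrix.of fun i j ↦ f i (y j)).det ≠ 0 := by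
  obtain ⟨y, hy⟩ := exists_dual_family hf
  refine ⟨y, ?_⟩
  have : (Matrix.of fun i j ↦ f i (y j)) = 1 := by
    ext i j; simp [hy, Matrix.one_apply]
  simp [this]

/-- The kernel of `f₁ ∧ … ∧ f_m` is the common kernel of the `f_i`. -/
theorem forall_det_eq_zero_iff {f : ι → V →ₗ[ℝ] ℝ} (hf : LinearIndependent ℝ f) (v : V) :
    (∀ (y : ι → V) (i : ι), y i = v → (Matrix.of fun i j ↦ f i (y j)).det = 0) ↔
      ∀ i, f i v = 0 := by
  refine ⟨fun h i ↦ ?_, fun h y i hi ↦ Matrix.det_eq_zero_of_column_eq_zero i fun j ↦ ?_⟩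
  · obtain ⟨y, hy⟩ := exists_dual_family hf
    -- With `v` in place of the `i`-th dual vector the determinant is `f i v`, by Cramer's rule.
    have h1 := h (Function.update y i v) i (Function.update_self i v y)
    have h2 : (Matrix.of fun i' j ↦ f i' (Function.update y i v j)) =
        (1 : Matrix ι ι ℝ).updateCol i fun j ↦ f j v := by
      ext a b
      rw [Matrix.updateCol_apply, Matrix.of_apply, Function.update_apply]
      split_ifs with hb
      · rfl
      · rw [hy, Matrix.one_apply]
    rw [h2, ← Matrix.cramer_apply, Matrix.cramer_one] at h1
    exact h1
  · simp [hi, h]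

end LinearAlgebra

/-! ### Differential inequalities on the line. -/

section RealAnalysis

/-- A differentiable function stays nonnegative if near every point it satisfies, wherever it is
negative, a linear differential inequality `f' ≥ (p'/p) f` for some positive `p`. -/
theorem nonneg_of_mul_deriv_le {f f' : ℝ → ℝ} (hf : ∀ s, HasDerivAt f (f' s) s)
    (hloc : ∀ s₀, ∃ p p' : ℝ → ℝ, 0 < p s₀ ∧ (∀ s, HasDerivAt p (p' s) s) ∧
      ∀ s, 0 < p s → f s < 0 → p' s * f s ≤ f' s * p s)
    {a b : ℝ} (hab : a ≤ b) (ha : 0 ≤ f a) : 0 ≤ f b := by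
  have hfc : Continuous f := continuous_iff_continuousAt.2 fun s ↦ (hf s).continuousAt
  by_contra! hb
  -- `s₀` is the last time in `[a, b]` with `f ≥ 0`; just after it `f / p` is nondecreasing, yet
  -- negative.
  have hcomp : IsCompact (Icc a b ∩ {s | 0 ≤ f s}) :=
    isCompact_Icc.inter_right (isClosed_le continuous_const hfc)
  obtain ⟨s₀, ⟨⟨hs₀a, hs₀b⟩, hs₀⟩, hmax⟩ := hcomp.exists_isGreatest ⟨a, ⟨le_rfl, hab⟩, ha⟩
  have hneg (s : ℝ) (h1 : s₀ < s) (h2 : s ≤ b) : f s < 0 := by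
    by_contra! h
    exact (hmax ⟨⟨hs₀a.trans h1.le, h2⟩, h⟩).not_gt h1
  have hlt : s₀ < b := by
    rcases hs₀b.lt_or_eq with h | rfl
    · exact h
    · exact absurd hs₀ hb.not_ge
  obtain ⟨p, p', hp₀, hp, hle⟩ := hloc s₀
  have hpos : ∀ᶠ s in 𝓝 s₀, 0 < p s := (hp s₀).continuousAt.eventually (lt_mem_nhds hp₀)
  obtain ⟨δ, hδ, hball⟩ := Metric.eventually_nhds_iff.1 hpos
  set t := min b (s₀ + δ / 2) with ht
  have hst : s₀ < t := lt_min hlt (by linarith)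
  have hpt (s : ℝ) (hs : s ∈ Icc s₀ t) : 0 < p s := by
    apply hball
    rw [Real.dist_eq, abs_lt]
    have := hs.2.trans (min_le_right _ _)
    constructor <;> linarith [hs.1]
  have hq (s : ℝ) (hs : s ∈ Icc s₀ t) :
      HasDerivAt (fun s ↦ f s / p s) ((f' s * p s - f s * p' s) / p s ^ 2) s :=
    (hf s).div (hp s) (hpt s hs).ne'
  have hmono : MonotoneOn (fun s ↦ f s / p s) (Icc s₀ t) := by
    apply monotoneOn_of_deriv_nonneg (convex_Icc _ _)
    · exact fun s hs ↦ (hq s hs).continuousAt.continuousWithinAt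
    · rw [interior_Icc]
      exact fun s hs ↦ (hq s ⟨hs.1.le, hs.2.le⟩).differentiableAt.differentiableWithinAt
    · rw [interior_Icc]
      intro s hs
      rw [(hq s ⟨hs.1.le, hs.2.le⟩).deriv]
      apply div_nonneg _ (sq_nonneg _)
      linarith [hle s (hpt s ⟨hs.1.le, hs.2.le⟩)
        (hneg s hs.1 (hs.2.le.trans (min_le_left _ _)))]
  have h1 := hmono ⟨le_rfl, hst.le⟩ ⟨hst.le, le_rfl⟩ hst.le
  have h2 : 0 ≤ f s₀ / p s₀ := div_nonneg hs₀ hp₀.le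
  have h3 : f t / p t < 0 :=
    div_neg_of_neg_of_pos (hneg t hst (min_le_left _ _)) (hpt t ⟨hst.le, le_rfl⟩)
  simp only at h1
  linarith

/-- A property of real numbers that propagates to neighbourhoods, in both directions, and holds at
one point holds everywhere. -/
theorem forall_of_eventually_iff {P : ℝ → Prop} (h : ∀ s₀, ∀ᶠ s in 𝓝 s₀, P s ↔ P s₀) {a : ℝ}
    (ha : P a) (s : ℝ) : P s := by
  have hopen : IsOpen {s | P s} :=
    isOpen_iff_mem_nhds.2 fun s₀ hs₀ ↦ (h s₀).mono fun s hs ↦ hs.2 hs₀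
  have hopen' : IsOpen {s | P s}ᶜ :=
    isOpen_iff_mem_nhds.2 fun s₀ hs₀ ↦ (h s₀).mono fun s hs hs' ↦ hs₀ (hs.1 hs')
  have := IsClopen.eq_univ ⟨⟨hopen'⟩, hopen⟩ ⟨a, ha⟩
  exact (this.symm ▸ mem_univ s : s ∈ {s | P s})

/-- Uniqueness of the zero solution of `q' = - c q`, where the coefficient `c` lies between the
logarithmic derivatives of a negative function `r` and a positive function `p`. -/
theorem eventually_eq_zero_of_hasDerivAt {q c p p' r r' : ℝ → ℝ}
    (hq : ∀ s, HasDerivAt q (-(c s * q s)) s)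
    (hp : ∀ s, HasDerivAt p (p' s) s) (hr : ∀ s, HasDerivAt r (r' s) s)
    (hcp : ∀ s, c s * p s ≤ p' s) (hcr : ∀ s, c s * r s ≤ r' s) {s₀ : ℝ}
    (hp₀ : 0 < p s₀) (hr₀ : r s₀ < 0) (hq₀ : q s₀ = 0) : ∀ᶠ s in 𝓝 s₀, q s = 0 := by
  have hev : ∀ᶠ s in 𝓝 s₀, 0 < p s ∧ r s < 0 :=
    ((hp s₀).continuousAt.eventually (lt_mem_nhds hp₀)).and
      ((hr s₀).continuousAt.eventually (gt_mem_nhds hr₀))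
  obtain ⟨δ, hδ, hball⟩ := Metric.eventually_nhds_iff_ball.1 hev
  have hder {p p' : ℝ → ℝ} (hp : ∀ s, HasDerivAt p (p' s) s) (s : ℝ) :
      HasDerivAt (fun s ↦ (q s * p s) ^ 2) (2 * q s ^ 2 * (p s * (p' s - c s * p s))) s := by
    have := ((hq s).mul (hp s)).pow 2
    refine this.congr_deriv ?_
    simp; ring
  have hconv : Convex ℝ (Metric.ball s₀ δ) := convex_ball _ _
  have hmono : MonotoneOn (fun s ↦ (q s * p s) ^ 2) (Metric.ball s₀ δ) := by
    apply monotoneOn_of_deriv_nonneg hconv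
    · exact fun s _ ↦ (hder hp s).continuousAt.continuousWithinAt
    · exact fun s _ ↦ (hder hp s).differentiableAt.differentiableWithinAt
    · intro s hs
      rw [(hder hp s).deriv]
      have := (hball s (interior_subset hs)).1
      have := sub_nonneg.2 (hcp s)
      positivity
  have hanti : AntitoneOn (fun s ↦ (q s * r s) ^ 2) (Metric.ball s₀ δ) := by
    apply antitoneOn_of_deriv_nonpos hconv
    · exact fun s _ ↦ (hder hr s).continuousAt.continuousWithinAt
    · exact fun s _ ↦ (hder hr s).differentiableAt.differentiableWithinAt
    · intro s hs
      rw [(hder hr s).deriv]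
      have := (hball s (interior_subset hs)).2
      exact mul_nonpos_of_nonneg_of_nonpos (by positivity)
        (mul_nonpos_of_nonpos_of_nonneg this.le (sub_nonneg.2 (hcr s)))
  filter_upwards [Metric.ball_mem_nhds s₀ hδ] with s hs
  have hs₀ : s₀ ∈ Metric.ball s₀ δ := Metric.mem_ball_self hδ
  -- No regularity of `c` is available: `p` controls the past of `s₀` and `r` its future.
  rcases le_total s s₀ with h | h
  · have := hmono hs hs₀ h
    simp only [hq₀, zero_mul, ne_eq, OfNat.ofNat_ne_zero, not_false_eq_true, zero_pow] at this
    have h0 := pow_eq_zero_iff two_ne_zero |>.1 (le_antisymm this (sq_nonneg _))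
    exact (mul_eq_zero.1 h0).resolve_right (hball s hs).1.ne'
  · have := hanti hs₀ hs h
    simp only [hq₀, zero_mul, ne_eq, OfNat.ofNat_ne_zero, not_false_eq_true, zero_pow] at this
    have h0 := pow_eq_zero_iff two_ne_zero |>.1 (le_antisymm this (sq_nonneg _))
    exact (mul_eq_zero.1 h0).resolve_right (hball s hs).2.ne

/-- If a curve of functions `F s` that never vanish identically satisfies `F' = ψ F`, its zero set
is constant. -/
theorem zero_set_const {Y : Type*} {F : ℝ → Y → ℝ} {ψ : ℝ → ℝ}
    (hF : ∀ s y, HasDerivAt (fun s ↦ F s y) (ψ s * F s y) s) (hne : ∀ s, ∃ y, F s y ≠ 0)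
    (y : Y) {a : ℝ} (ha : F a y = 0) (s : ℝ) : F s y = 0 := by
  refine forall_of_eventually_iff (P := fun s ↦ F s y = 0) (fun s₀ ↦ ?_) ha s
  obtain ⟨y₀, hy₀⟩ := hne s₀
  have hev : ∀ᶠ s in 𝓝 s₀, F s y₀ ≠ 0 := (hF s₀ y₀).continuousAt.eventually_ne hy₀
  obtain ⟨δ, hδ, hball⟩ := Metric.eventually_nhds_iff_ball.1 hev
  have hder (s : ℝ) (hs : s ∈ Metric.ball s₀ δ) :
      HasDerivAt (fun s ↦ F s y / F s y₀) 0 s := by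
    refine ((hF s y).div (hF s y₀) (hball s hs)).congr_deriv ?_
    ring
  filter_upwards [Metric.ball_mem_nhds s₀ hδ] with s hs
  have hs₀ : s₀ ∈ Metric.ball s₀ δ := Metric.mem_ball_self hδ
  have h := Metric.isOpen_ball.is_const_of_deriv_eq_zero (convex_ball s₀ δ).isPreconnected
    (fun s hs ↦ (hder s hs).differentiableAt.differentiableWithinAt)
    (fun s hs ↦ (hder s hs).deriv) hs hs₀
  constructor
  · intro h0
    rw [h0, zero_div] at h
    exact (div_eq_zero_iff.1 h.symm).resolve_right hy₀
  · intro h0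
    rw [h0, zero_div] at h
    exact (div_eq_zero_iff.1 h).resolve_right (hball s hs)

end RealAnalysis

/-! ### Causal families of scalar products on one vector space. -/

section Families

variable {V : Type*} [AddCommGroup V] [Module ℝ V]

/-- A differentiable curve `G` of Lorentzian scalar products on a fixed vector space whose
derivative `D s` is, at each `s`, nonnegative on the null vectors of `G s`. -/
structure IsCausalFamily (G D : ℝ → LinearMap.BilinForm ℝ V) : Prop where
  lorentz (s : ℝ) : IsLorentzian (G s)
  hasDerivAt (s : ℝ) (u v : V) : HasDerivAt (fun s ↦ G s u v) (D s u v) s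
  nonneg (s : ℝ) (k : V) : G s k k = 0 → 0 ≤ D s k k

namespace IsCausalFamily

variable {G D : ℝ → LinearMap.BilinForm ℝ V} (h : IsCausalFamily G D)
include h

theorem symm_deriv (s : ℝ) (u v : V) : D s u v = D s v u := by
  refine (h.hasDerivAt s u v).unique ?_
  simpa only [(h.lorentz _).symm v u] using h.hasDerivAt s v u

theorem nonneg_of_le {a b : ℝ} (hab : a ≤ b) {u : V} (hu : 0 ≤ G a u u) : 0 ≤ G b u u := by
  refine nonneg_of_mul_deriv_le (f := fun s ↦ G s u u) (fun s ↦ h.hasDerivAt s u u) (fun s₀ ↦ ?_)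
    hab hu
  obtain ⟨e, he, -⟩ := (h.lorentz s₀).signature
  exact ⟨fun s ↦ G s e e, fun s ↦ D s e e, he, fun s ↦ h.hasDerivAt s e e, fun s hs hu ↦
    cone_quotient_le (h.lorentz s).symm (h.symm_deriv s) (h.nonneg s) hs hu⟩

/-- All vectors near `u` are timelike at time `a`, hence causal at `b`. If `G b u u = 0`, then `u`
would be a local minimum of the quadratic form, so `G b u = 0`. -/
theorem pos_of_le {a b : ℝ} (hab : a ≤ b) {u : V} (hu : 0 < G a u u) : 0 < G b u u := by
  refine lt_of_le_of_ne (h.nonneg_of_le hab hu.le) fun h0 ↦ ?_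
  have hu0 : u ≠ 0 := by rintro rfl; simp at hu
  obtain ⟨v, hv⟩ : ∃ v, G b u v ≠ 0 := by
    by_contra! hc
    exact hu0 ((h.lorentz b).eq_zero_of_forall hc)
  have hev : ∀ᶠ t in 𝓝 (0 : ℝ), 0 < G a (u + t • v) (u + t • v) := by
    simp_rw [bilin_add_smul_self (h.lorentz a).symm]
    have : ContinuousAt (fun t : ℝ ↦ G a u u + 2 * t * G a u v + t ^ 2 * G a v v) 0 := by fun_prop
    exact this.eventually (lt_mem_nhds (by simpa using hu))
  have hd : HasDerivAt (fun t : ℝ ↦ G b (u + t • v) (u + t • v)) (2 * G b u v) 0 := by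
    simp_rw [bilin_add_smul_self (h.lorentz b).symm]
    have h1 : HasDerivAt (fun t : ℝ ↦ 2 * t * G b u v) (2 * 1 * G b u v) 0 :=
      ((hasDerivAt_id (0 : ℝ)).const_mul 2).mul_const _
    have h2 : HasDerivAt (fun t : ℝ ↦ t ^ 2 * G b v v) (2 * 0 * G b v v) 0 := by
      simpa using (hasDerivAt_pow 2 (0 : ℝ)).mul_const (G b v v)
    refine ((h1.const_add (G b u u)).add h2).congr_deriv ?_
    ring
  have hmin : IsLocalMin (fun t : ℝ ↦ G b (u + t • v) (u + t • v)) 0 := by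
    filter_upwards [hev] with t ht
    simpa [← h0] using h.nonneg_of_le hab ht.le
  exact hv (by simpa using hmin.hasDerivAt_eq_zero hd)

theorem deriv_eq_zero_of_null {a b : ℝ} (hab : a < b) {k : V} (ha : G a k k = 0)
    (hb : G b k k = 0) : D a k k = 0 := by
  have hz (s : ℝ) (hs : s ∈ Icc a b) : G s k k = 0 := by
    refine le_antisymm ?_ (h.nonneg_of_le hs.1 ha.ge)
    by_contra! hpos
    exact absurd hb (h.pos_of_le hs.2 hpos).ne'
  have h1 : HasDerivWithinAt (fun s ↦ G s k k) (D a k k) (Icc a b) a :=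
    (h.hasDerivAt a k k).hasDerivWithinAt
  have h2 : HasDerivWithinAt (fun s ↦ G s k k) 0 (Icc a b) a :=
    (hasDerivWithinAt_const a (Icc a b) (0 : ℝ)).congr hz (ha)
  exact (uniqueDiffOn_Icc hab a ⟨le_rfl, hab.le⟩).eq_deriv _ h1 h2

theorem injective (s : ℝ) : Function.Injective (G s) :=
  (injective_iff_map_eq_zero _).2 fun u hu ↦
    (h.lorentz s).eq_zero_of_forall fun v ↦ by rw [hu]; rfl

theorem surjective [FiniteDimensional ℝ V] (s : ℝ) : Function.Surjective (G s) :=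
  (LinearMap.injective_iff_surjective_of_finrank_eq_finrank
    (Subspace.dual_finrank_eq (K := ℝ) (V := V)).symm).1 (h.injective s)

/-- The vectors `w s` dual, with respect to `G s`, to a fixed linear form `θ`. -/
theorem exists_dual [FiniteDimensional ℝ V] (θ : V →ₗ[ℝ] ℝ) :
    ∃ w : ℝ → V, (∀ s v, G s (w s) v = θ v) ∧
      ∀ s, HasDerivAt (fun s ↦ θ (w s)) (-(D s (w s) (w s))) s := by
  choose w hw using fun s ↦ h.surjective s θ
  have hwv (s : ℝ) (v : V) : G s (w s) v = θ v := by rw [hw]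
  refine ⟨w, hwv, fun s₀ ↦ ?_⟩
  -- Inverting the Gram matrix gives continuity of `w`, which is all that the derivative below
  -- needs.
  let b := Module.finBasis ℝ V
  let N : ℝ → Matrix _ _ ℝ := fun s ↦ Matrix.of fun i j ↦ G s (b i) (b j)
  have hN (s : ℝ) (c : _ → ℝ) (i) : (N s).mulVec c i = G s (b i) (∑ j, c j • b j) := by
    simp [N, Matrix.mulVec, dotProduct, mul_comm]
  have hdet (s : ℝ) : IsUnit (N s).det := by
    rw [isUnit_iff_ne_zero]
    intro h0
    obtain ⟨c, hc0, hc⟩ := Matrix.exists_mulVec_eq_zero_iff.2 h0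
    have : ∑ j, c j • b j = 0 := by
      refine h.injective s (b.ext fun i ↦ ?_)
      rw [(h.lorentz s).symm, ← hN, hc]; simp
    exact hc0 (funext fun i ↦ Fintype.linearIndependent_iff.1 b.linearIndependent c this i)
  have hcoord (s : ℝ) : (b.repr (w s) : _ → ℝ) = (N s)⁻¹.mulVec (fun i ↦ θ (b i)) := by
    have h1 : (N s).mulVec (b.repr (w s)) = fun i ↦ θ (b i) := by
      ext i
      rw [hN, b.sum_repr, (h.lorentz s).symm, hwv]
    rw [← h1, Matrix.mulVec_mulVec, Matrix.nonsing_inv_mul _ (hdet s), Matrix.one_mulVec]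
  have hNc : Continuous N := continuous_matrix fun i j ↦
    continuous_iff_continuousAt.2 fun s ↦ (h.hasDerivAt s (b i) (b j)).continuousAt
  have hcont : Continuous fun s ↦ (b.repr (w s) : _ → ℝ) := by
    simp_rw [hcoord, Matrix.inv_def, Ring.inverse_eq_inv']
    refine Continuous.matrix_mulVec ?_ continuous_const
    exact (hNc.matrix_det.inv₀ fun s ↦ (hdet s).ne_zero).smul hNc.matrix_adjugate
  -- By duality `θ (w s) - θ (w s₀) = -(G s - G s₀) (w s₀) (w s)`, so `w` itself need not be
  -- differentiated.
  have hslope (s : ℝ) : slope (fun s ↦ θ (w s)) s₀ s =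
      -∑ i, b.repr (w s) i * slope (fun s ↦ G s (w s₀) (b i)) s₀ s := by
    have h1 : θ (w s) - θ (w s₀) = -∑ i, b.repr (w s) i *
        (G s (w s₀) (b i) - G s₀ (w s₀) (b i)) := by
      have h2 (t : ℝ) : ∑ i, b.repr (w s) i * G t (w s₀) (b i) = G t (w s₀) (w s) := by
        conv_rhs => rw [← b.sum_repr (w s)]
        rw [map_sum]
        exact Finset.sum_congr rfl fun i _ ↦ by rw [map_smul, smul_eq_mul]
      simp_rw [mul_sub, Finset.sum_sub_distrib, h2, hwv]
      rw [(h.lorentz s).symm, hwv]; ring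
    simp_rw [slope_def_field, h1, neg_div, Finset.sum_div, mul_div_assoc]
  rw [hasDerivAt_iff_tendsto_slope]
  have hlim : Filter.Tendsto
      (fun s ↦ -∑ i, b.repr (w s) i * slope (fun s ↦ G s (w s₀) (b i)) s₀ s) (𝓝[≠] s₀)
      (𝓝 (-∑ i, b.repr (w s₀) i * D s₀ (w s₀) (b i))) := by
    refine (tendsto_finsetSum _ fun i _ ↦ Filter.Tendsto.mul ?_ ?_).neg
    · exact ((continuous_apply i).comp hcont).continuousAt.tendsto.mono_left nhdsWithin_le_nhds
    · exact hasDerivAt_iff_tendsto_slope.1 (h.hasDerivAt s₀ (w s₀) (b i))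
  have hval : ∑ i, b.repr (w s₀) i * D s₀ (w s₀) (b i) = D s₀ (w s₀) (w s₀) := by
    conv_rhs => rw [← b.sum_repr (w s₀)]
    rw [map_sum]
    refine Finset.sum_congr rfl fun i _ ↦ ?_
    rw [map_smul, b.sum_repr]; rfl
  rw [hval] at hlim
  exact hlim.congr fun s ↦ (hslope s).symm

/-- Null vectors dual to the same linear form at different times are proportional. -/
theorem exists_smul_of_dual {a b : ℝ} (hab : a ≤ b) {θ : V →ₗ[ℝ] ℝ} {x y : V}
    (hx : ∀ v, G a x v = θ v) (hy : ∀ v, G b y v = θ v) (hxn : θ x = 0) (hyn : θ y = 0)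
    (hy0 : y ≠ 0) : ∃ r : ℝ, x = r • y := by
  -- `x` is `G b`-orthogonal to the null vector `y`, so it cannot be timelike, while monotonicity
  -- keeps it causal.
  have h1 := (h.lorentz b).orthogonal_null (k := y) (n := x) (by rw [hy, hyn]) hy0
    (by rw [hy, hxn])
  have h2 : 0 ≤ G b x x := h.nonneg_of_le hab (by rw [hx, hxn])
  exact h1.2 (le_antisymm h1.1 h2)

/-- If the orthogonal complement `K` of the null vectors annihilated by the derivative is
constant, these vectors remain null at all times. -/
theorem null_of_orthogonal_const [FiniteDimensional ℝ V] {K : Set V}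
    (hK : ∀ s v, v ∈ K ↔ ∀ k, G s k k = 0 → D s k k = 0 → G s k v = 0)
    {a : ℝ} {k : V} (hk : G a k k = 0) (hDk : D a k k = 0) (s : ℝ) : G s k k = 0 := by
  by_cases hk0 : k = 0
  · simp [hk0]
  set θ : V →ₗ[ℝ] ℝ := G a k with hθ
  have hθ0 : θ ≠ 0 := fun h0 ↦ hk0 ((h.lorentz a).eq_zero_of_forall fun v ↦ by
    rw [← hθ, h0]; rfl)
  obtain ⟨w, hw, hderiv⟩ := h.exists_dual θ
  have hwa : w a = k := by
    rw [← sub_eq_zero]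
    exact (h.lorentz a).eq_zero_of_forall fun v ↦ by simp [hw, hθ]
  have hw0 (s : ℝ) : w s ≠ 0 := fun h0 ↦ hθ0 (LinearMap.ext fun v ↦ by rw [← hw s, h0]; simp)
  -- Double annihilator: a functional `G s y` killing the span has `y ∈ K`, and `K`, being also the
  -- complement at time `a`, is killed by `θ`.
  have hspan (s : ℝ) : w s ∈ Submodule.span ℝ {k | G s k k = 0 ∧ D s k k = 0} := by
    rw [← Subspace.forall_mem_dualAnnihilator_apply_eq_zero_iff]
    intro f hf
    rw [Submodule.mem_dualAnnihilator] at hf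
    obtain ⟨y, rfl⟩ := h.surjective s f
    have hy : y ∈ K := (hK s y).2 fun k' h1 h2 ↦ by
      rw [(h.lorentz s).symm]
      exact hf k' (Submodule.subset_span ⟨h1, h2⟩)
    rw [(h.lorentz s).symm, hw]
    exact (hK a y).1 hy k hk hDk
  -- Without spacelike vectors there are no nonzero null ones, so `K` would be everything and `θ`
  -- zero.
  have hneg (s : ℝ) : ∃ v, G s v v < 0 := by
    by_contra! hc
    have hD (k' : V) (hk' : G s k' k' = 0) : k' = 0 := by
      by_contra hk0'
      obtain ⟨v, hv⟩ := (h.lorentz s).exists_neg_of_null hk' hk0'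
      exact (hc v).not_gt hv
    have : ∀ v, v ∈ K := fun v ↦ (hK s v).2 fun k' hk' _ ↦ by simp [hD k' hk']
    exact hθ0 (LinearMap.ext fun v ↦ (hK a v).1 (this v) k hk hDk)
  choose c hc using fun s ↦ (hneg s).elim fun v hv ↦
    exists_forall_mul_le (h.lorentz s) (h.symm_deriv s) (h.nonneg s) hv
  have hDw (s : ℝ) : D s (w s) (w s) = c s * θ (w s) := by
    rw [apply_eq_mul_of_mem_span (h.lorentz s).symm (h.symm_deriv s) (hc s) (hspan s), hw]
  have hq (s : ℝ) : θ (w s) = 0 := by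
    have hder (s : ℝ) : HasDerivAt (fun s ↦ θ (w s)) (-(c s * θ (w s))) s := by
      rw [← hDw]; exact hderiv s
    have hcont : Continuous fun s ↦ θ (w s) :=
      continuous_iff_continuousAt.2 fun s ↦ (hder s).continuousAt
    refine forall_of_eventually_iff (P := fun s ↦ θ (w s) = 0) (fun s₀ ↦ ?_)
      (show θ (w a) = 0 by rw [hwa, hθ, hk]) s
    by_cases hs₀ : θ (w s₀) = 0
    · obtain ⟨e, he, -⟩ := (h.lorentz s₀).signature
      obtain ⟨v, hv⟩ := hneg s₀
      filter_upwards [eventually_eq_zero_of_hasDerivAt (q := fun s ↦ θ (w s)) hder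
        (fun s ↦ h.hasDerivAt s e e) (fun s ↦ h.hasDerivAt s v v) (fun s ↦ hc s e)
        (fun s ↦ hc s v) he hv hs₀] with s hs
      exact iff_of_true hs hs₀
    · filter_upwards [hcont.continuousAt.eventually_ne hs₀] with s hs
      exact iff_of_false hs hs₀
  have hww : G s (w s) (w s) = 0 := by rw [hw, hq]
  have hθk : θ k = 0 := by rw [hθ, hk]
  have hprop : ∃ r : ℝ, k = r • w s := by
    rcases le_total a s with has | has
    · exact h.exists_smul_of_dual has (fun v ↦ rfl) (hw s) hθk (hq s) (hw0 s)
    · obtain ⟨r, hr⟩ := h.exists_smul_of_dual has (hw s) (fun v ↦ rfl) (hq s) hθk hk0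
      have hr0 : r ≠ 0 := by rintro rfl; exact hw0 s (by simpa using hr)
      exact ⟨r⁻¹, by rw [hr, inv_smul_smul₀ hr0]⟩
  obtain ⟨r, hr⟩ := hprop
  rw [hr]; simp [hww]

end IsCausalFamily

end Families

/-! ### Differentiating pull-backs along the flow. -/

section Flows

variable {E : Type*} [NormedAddCommGroup E] [NormedSpace ℝ E]
  {M : Type*} [TopologicalSpace M] [ChartedSpace E M]

namespace IsGlobalFlow

variable {ξ : ∀ x : M, TangentSpace 𝓘(ℝ, E) x} {φ : ℝ → M → M} (hφ : IsGlobalFlow ξ φ)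
include hφ

theorem contMDiff_apply (s : ℝ) : ContMDiff 𝓘(ℝ, E) 𝓘(ℝ, E) ∞ (φ s) :=
  hφ.contMDiff.comp (contMDiff_const.prodMk contMDiff_id)

theorem map_add_eq (s t : ℝ) : φ (s + t) = φ s ∘ φ t := funext fun x ↦ hφ.map_add s t x

theorem continuous_orbit (x : M) : Continuous fun s ↦ φ s x :=
  hφ.contMDiff.continuous.comp (continuous_id.prodMk continuous_const)

theorem contMDiff_orbit (x : M) : ContMDiff 𝓘(ℝ, ℝ) 𝓘(ℝ, E) 1 fun s ↦ φ s x :=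
  (hφ.contMDiff.comp (contMDiff_id.prodMk contMDiff_const)).of_le (by simp)

theorem mdifferentiable (s : ℝ) : MDifferentiable 𝓘(ℝ, E) 𝓘(ℝ, E) (φ s) :=
  (hφ.contMDiff_apply s).mdifferentiable (by simp)

/-- The diffeomorphism `φ_s`, with inverse `φ_{-s}`. -/
def diffeomorph (s : ℝ) : Diffeomorph 𝓘(ℝ, E) 𝓘(ℝ, E) M M ∞ where
  toFun := φ s
  invFun := φ (-s)
  left_inv x := by rw [← hφ.map_add, neg_add_cancel, hφ.map_zero]
  right_inv x := by rw [← hφ.map_add, add_neg_cancel, hφ.map_zero]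
  contMDiff_toFun := hφ.contMDiff_apply s
  contMDiff_invFun := hφ.contMDiff_apply (-s)

theorem push_injective (s : ℝ) (x : M) : Function.Injective (push (E := E) (φ s) x) :=
  ((hφ.diffeomorph s).mfderivToContinuousLinearEquiv (by simp) x).injective

theorem push_surjective (s : ℝ) (x : M) : Function.Surjective (push (E := E) (φ s) x) :=
  ((hφ.diffeomorph s).mfderivToContinuousLinearEquiv (by simp) x).surjective

theorem push_comp (s t : ℝ) (x : M) :
    push (E := E) (φ s ∘ φ t) x = (push (φ s) (φ t x)).comp (push (φ t) x) :=
  mfderiv_comp x (hφ.mdifferentiable s _) (hφ.mdifferentiable t _)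

variable [IsManifold 𝓘(ℝ, E) ∞ M]

theorem pullMetric_add (g : LorentzMetric E M) (s t : ℝ) (x : M) (u v : TangentSpace 𝓘(ℝ, E) x) :
    pullMetric g (φ (s + t)) x u v =
      pullMetric g (φ s) (φ t x) (push (φ t) x u) (push (φ t) x v) := by
  rw [hφ.map_add_eq]
  unfold pullMetric
  rw [hφ.push_comp]
  rfl

theorem pullForm_add {m : ℕ} (Ω : DiffForm E M m) (s t : ℝ) (x : M)
    (v : Fin m → TangentSpace 𝓘(ℝ, E) x) :
    pullForm Ω (φ (s + t)) x v = pullForm Ω (φ s) (φ t x) fun i ↦ push (φ t) x (v i) := by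
  rw [hφ.map_add_eq]
  unfold pullForm
  rw [hφ.push_comp]
  rfl

theorem pullMetric_zero (g : LorentzMetric E M) (x : M) (u v : TangentSpace 𝓘(ℝ, E) x) :
    pullMetric g (φ 0) x u v = g.val x u v := by
  have h : φ 0 = id := funext hφ.map_zero
  unfold pullMetric push
  rw [h, mfderiv_id]
  rfl

/-- The push-forward of a fixed tangent vector is a smooth curve in the tangent bundle. -/
theorem contMDiff_push (x : M) (u : TangentSpace 𝓘(ℝ, E) x) :
    ContMDiff 𝓘(ℝ, ℝ) (𝓘(ℝ, E).prod 𝓘(ℝ, E)) 1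
      (fun s : ℝ ↦ (TotalSpace.mk' E (φ s x) (push (φ s) x u) : TangentBundle 𝓘(ℝ, E) M)) := by
  have : IsManifold 𝓘(ℝ, E) 1 M := IsManifold.of_le (n := ∞) (by simp)
  -- The curve is the tangent map of `(s, y) ↦ φ s y` applied to `(0, u)` at `(s, x)`.
  have h1 : ContMDiff 𝓘(ℝ, ℝ) (𝓘(ℝ, ℝ).prod 𝓘(ℝ, ℝ)) 1
      (fun s : ℝ ↦ (⟨s, 0⟩ : TangentBundle 𝓘(ℝ, ℝ) ℝ)) :=
    contMDiff_zeroSection ℝ (TangentSpace 𝓘(ℝ, ℝ) : ℝ → Type)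
  have h2 : ContMDiff 𝓘(ℝ, ℝ) (𝓘(ℝ, E).prod 𝓘(ℝ, E)) 1
      (fun _ : ℝ ↦ (⟨x, u⟩ : TangentBundle 𝓘(ℝ, E) M)) := contMDiff_const
  have h3 := (hφ.contMDiff.contMDiff_tangentMap (m := 1) (by decide)).comp
    (contMDiff_equivTangentBundleProd_symm.comp (h1.prodMk h2))
  refine h3.congr fun s ↦ ?_
  have hs : MDifferentiableAt (𝓘(ℝ, ℝ).prod 𝓘(ℝ, E)) 𝓘(ℝ, E)
      (fun p : ℝ × M ↦ φ p.1 p.2) (s, x) := hφ.contMDiff.mdifferentiable (by simp) _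
  have h4 : push (φ s) x u =
      mfderiv (𝓘(ℝ, ℝ).prod 𝓘(ℝ, E)) 𝓘(ℝ, E) (fun p : ℝ × M ↦ φ p.1 p.2) (s, x) (0, u) := by
    have h5 : φ s = (fun p : ℝ × M ↦ φ p.1 p.2) ∘ fun y ↦ (s, y) := rfl
    have h6 : MDifferentiableAt 𝓘(ℝ, E) (𝓘(ℝ, ℝ).prod 𝓘(ℝ, E)) (fun y : M ↦ (s, y)) x :=
      (contMDiff_const.prodMk contMDiff_id).mdifferentiable (n := 1) (by simp) _
    unfold push
    conv_lhs => rw [h5]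
    rw [mfderiv_comp x hs h6, mfderiv_prod_right]
    rfl
  simp only [h4]
  rfl

theorem differentiable_pullMetric (g : LorentzMetric E M) (x : M)
    (u v : TangentSpace 𝓘(ℝ, E) x) : Differentiable ℝ fun s ↦ pullMetric g (φ s) x u v := by
  have h1 := g.contMDiff.comp (hφ.contMDiff_orbit x)
  have h2 := ContMDiff.clm_bundle_apply₂ (E₃ := Bundle.Trivial M ℝ) (F₃ := ℝ) h1
    (hφ.contMDiff_push x u) (hφ.contMDiff_push x v)
  intro s
  have h3 := (contMDiffAt_totalSpace.1 (h2 s)).2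
  exact (contMDiffAt_iff_contDiffAt.1 h3).differentiableAt (by simp)

/-- The group law moves the derivative at time `s` to the derivative at time `0` based at `φ s x`.
-/
theorem hasDerivAt_pullMetric (g : LorentzMetric E M) (x : M)
    (u v : TangentSpace 𝓘(ℝ, E) x) (s : ℝ) :
    HasDerivAt (fun s ↦ pullMetric g (φ s) x u v)
      (lieMetric g φ (φ s x) (push (φ s) x u) (push (φ s) x v)) s := by
  have h1 : HasDerivAt (fun t ↦ pullMetric g (φ t) (φ s x) (push (φ s) x u) (push (φ s) x v))
      (lieMetric g φ (φ s x) (push (φ s) x u) (push (φ s) x v)) (s - s) := by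
    rw [sub_self]
    exact (hφ.differentiable_pullMetric g _ _ _ 0).hasDerivAt
  have h2 := h1.comp_sub_const s s
  refine h2.congr_of_eventuallyEq (Filter.Eventually.of_forall fun t ↦ ?_)
  simp only
  rw [← hφ.pullMetric_add, sub_add_cancel]

theorem continuous_pairing (g : LorentzMetric E M) (τ : CausalOrientation g) (x : M)
    (u : TangentSpace 𝓘(ℝ, E) x) :
    Continuous fun s ↦ g.val (φ s x) (τ.field (φ s x)) (push (φ s) x u) := by
  have h1 := (g.contMDiff.comp (hφ.contMDiff_orbit x)).of_le (zero_le : (0 : WithTop ℕ∞) ≤ 1)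
  have h0 : ContMDiff 𝓘(ℝ, ℝ) (𝓘(ℝ, E).prod 𝓘(ℝ, E)) 0
      (fun s : ℝ ↦ (TotalSpace.mk' E (φ s x) (τ.field (φ s x)) : TangentBundle 𝓘(ℝ, E) M)) :=
    contMDiff_zero_iff.2 (τ.continuous.comp (hφ.continuous_orbit x))
  have h2 := ContMDiff.clm_bundle_apply₂ (E₃ := Bundle.Trivial M ℝ) (F₃ := ℝ) h1
    h0 ((hφ.contMDiff_push x u).of_le zero_le)
  rw [continuous_iff_continuousAt]
  intro s
  exact (contMDiffAt_totalSpace.1 (h2 s)).2.continuousAt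

theorem differentiable_pullForm {m : ℕ} (Ω : DiffForm E M m) (x : M)
    (v : Fin m → TangentSpace 𝓘(ℝ, E) x) : Differentiable ℝ fun s ↦ pullForm Ω (φ s) x v := by
  have h1 := Ω.contMDiff.comp (hφ.contMDiff_orbit x)
  intro s₀
  have h2 := (contMDiffAt_iff_contDiffAt.1 (contMDiffAt_totalSpace.1 (h1 s₀)).2).differentiableAt
    (by simp)
  have h3 (i : Fin m) := (contMDiffAt_iff_contDiffAt.1
    (contMDiffAt_totalSpace.1 (hφ.contMDiff_push x (v i) s₀)).2).differentiableAt (by simp)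
  have h4 : ∀ᶠ s in 𝓝 s₀, φ s x ∈ (trivializationAt E (TangentSpace 𝓘(ℝ, E)) (φ s₀ x)).baseSet :=
    (hφ.continuous_orbit x).continuousAt.eventually_mem
      ((trivializationAt E (TangentSpace 𝓘(ℝ, E)) (φ s₀ x)).open_baseSet.mem_nhds
        (FiberBundle.mem_baseSet_trivializationAt' _))
  have h5 := h2.continuousAlternatingMap_apply h3
  refine h5.congr_of_eventuallyEq ?_
  filter_upwards [h4] with s hs
  -- Coordinates cancel between form and vectors only over the base set of the trivialization.
  have h6 (u : TangentSpace 𝓘(ℝ, E) (φ s x)) :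
      (trivializationAt E (TangentSpace 𝓘(ℝ, E)) (φ s₀ x)).symmL ℝ (φ s x)
        (trivializationAt E (TangentSpace 𝓘(ℝ, E)) (φ s₀ x) ⟨φ s x, u⟩).2 = u := by
    rw [← Trivialization.continuousLinearMapAt_apply_of_mem (R := ℝ) _ hs,
      Trivialization.symmL_continuousLinearMapAt _ hs]
  rw [FiberBundle.trivializationAt_continuousAlternatingMap_apply]
  simp only [ContinuousAlternatingMap.inCoordinates, Function.comp_apply,
    ContinuousAlternatingMap.compContinuousLinearMap_apply,
    ContinuousLinearMap.compContinuousAlternatingMap_coe, Function.comp_def, h6]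
  exact (DFunLike.congr_fun
    (Bundle.Trivial.continuousLinearMapAt_trivialization (𝕜 := ℝ) M ℝ (φ s x)) _).symm

theorem hasDerivAt_pullForm {m : ℕ} (Ω : DiffForm E M m) (x : M)
    (v : Fin m → TangentSpace 𝓘(ℝ, E) x) (s : ℝ) :
    HasDerivAt (fun s ↦ pullForm Ω (φ s) x v)
      (lieForm Ω φ (φ s x) fun i ↦ push (φ s) x (v i)) s := by
  have h1 : HasDerivAt (fun t ↦ pullForm Ω (φ t) (φ s x) fun i ↦ push (φ s) x (v i))
      (lieForm Ω φ (φ s x) fun i ↦ push (φ s) x (v i)) (s - s) := by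
    rw [sub_self]
    exact (hφ.differentiable_pullForm Ω _ _ 0).hasDerivAt
  have h2 := h1.comp_sub_const s s
  refine h2.congr_of_eventuallyEq (Filter.Eventually.of_forall fun t ↦ ?_)
  simp only
  rw [← hφ.pullForm_add, sub_add_cancel]

theorem pairing_zero (g : LorentzMetric E M) (τ : CausalOrientation g) (x : M)
    (u : TangentSpace 𝓘(ℝ, E) x) :
    g.val (φ 0 x) (τ.field (φ 0 x)) (push (φ 0) x u) = g.val x (τ.field x) u := by
  have h : φ 0 = id := funext hφ.map_zero
  unfold push
  rw [h, mfderiv_id]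
  rfl

end IsGlobalFlow

end Flows

/-! ### From the manifold to causal families, and back. -/

section Metrics

variable {E : Type*} [NormedAddCommGroup E] [NormedSpace ℝ E]
  {M : Type*} [TopologicalSpace M] [ChartedSpace E M] [IsManifold 𝓘(ℝ, E) ∞ M]

namespace LorentzMetric

/-- The scalar product at a point as an algebraic bilinear form. -/
def form (g : LorentzMetric E M) (x : M) : LinearMap.BilinForm ℝ (TangentSpace 𝓘(ℝ, E) x) :=
  LinearMap.mk₂ ℝ (fun u v ↦ g.val x u v) (by simp) (by simp) (by simp) (by simp)

theorem isLorentzian_form (g : LorentzMetric E M) (x : M) : IsLorentzian (g.form x) :=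
  ⟨g.symm x, g.signature x⟩

theorem field_apply_ne_zero (g : LorentzMetric E M) (τ : CausalOrientation g) {x : M}
    {u : TangentSpace 𝓘(ℝ, E) x} (hu : u ≠ 0) (huu : 0 ≤ g.val x u u) :
    g.val x (τ.field x) u ≠ 0 :=
  (g.isLorentzian_form x).ne_zero_of_timelike (τ.timelike x) hu huu

theorem futureNull_or_neg (g : LorentzMetric E M) (τ : CausalOrientation g) {x : M}
    {k : TangentSpace 𝓘(ℝ, E) x} (hk : k ≠ 0) (hkk : g.val x k k = 0) :
    k ∈ futureNull g τ x ∨ -k ∈ futureNull g τ x := by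
  rcases (g.field_apply_ne_zero τ hk hkk.ge).lt_or_gt with h | h
  · exact .inr ⟨by simpa using hkk, by simpa using h⟩
  · exact .inl ⟨hkk, h⟩

end LorentzMetric

theorem lieMetric_neg_neg (g : LorentzMetric E M) (φ : ℝ → M → M) (x : M)
    (u v : TangentSpace 𝓘(ℝ, E) x) : lieMetric g φ x (-u) (-v) = lieMetric g φ x u v := by
  simp [lieMetric, pullMetric]

theorem futureNull_subset_futureCausal (g : LorentzMetric E M) (τ : CausalOrientation g) (x : M) :
    futureNull g τ x ⊆ futureCausal g τ x :=
  fun _ hk ↦ ⟨hk.1.ge, hk.2⟩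

namespace IsGlobalFlow

variable {ξ : ∀ x : M, TangentSpace 𝓘(ℝ, E) x} {φ : ℝ → M → M} (hφ : IsGlobalFlow ξ φ)

/-- The pulled back metrics `φ_s^* g` at a fixed point as bilinear forms. -/
def pullBilin (_ : IsGlobalFlow ξ φ) (g : LorentzMetric E M) (x : M) (s : ℝ) :
    LinearMap.BilinForm ℝ (TangentSpace 𝓘(ℝ, E) x) :=
  LinearMap.mk₂ ℝ (pullMetric g (φ s) x) (by simp [pullMetric]) (by simp [pullMetric])
    (by simp [pullMetric]) (by simp [pullMetric])

/-- The derivatives of the pulled back metrics `φ_s^* g` at a fixed point as bilinear forms. -/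
def derivBilin (g : LorentzMetric E M) (x : M) (s : ℝ) :
    LinearMap.BilinForm ℝ (TangentSpace 𝓘(ℝ, E) x) :=
  LinearMap.mk₂ ℝ (fun u v ↦ deriv (fun s ↦ pullMetric g (φ s) x u v) s)
    (fun u u' v ↦ by
      rw [← deriv_fun_add (hφ.differentiable_pullMetric g x u v s)
        (hφ.differentiable_pullMetric g x u' v s)]
      simp [pullMetric])
    (fun a u v ↦ by
      rw [smul_eq_mul, ← deriv_const_mul _ (hφ.differentiable_pullMetric g x u v s)]
      simp [pullMetric])
    (fun u v v' ↦ by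
      rw [← deriv_fun_add (hφ.differentiable_pullMetric g x u v s)
        (hφ.differentiable_pullMetric g x u v' s)]
      simp [pullMetric])
    (fun a u v ↦ by
      rw [smul_eq_mul, ← deriv_const_mul _ (hφ.differentiable_pullMetric g x u v s)]
      simp [pullMetric])

include hφ

theorem derivBilin_apply (g : LorentzMetric E M) (x : M) (s : ℝ)
    (u v : TangentSpace 𝓘(ℝ, E) x) :
    hφ.derivBilin g x s u v = lieMetric g φ (φ s x) (push (φ s) x u) (push (φ s) x v) :=
  (hφ.hasDerivAt_pullMetric g x u v s).deriv

theorem isLorentzian_pullBilin (g : LorentzMetric E M) (x : M) (s : ℝ) :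
    IsLorentzian (hφ.pullBilin g x s) where
  symm u v := g.symm _ _ _
  signature := by
    obtain ⟨e, he, hneg⟩ := g.signature (φ s x)
    obtain ⟨e, rfl⟩ := hφ.push_surjective s x e
    refine ⟨e, he, fun v hv hv0 ↦ hneg _ hv fun h0 ↦ hv0 ?_⟩
    exact hφ.push_injective s x (by rw [h0, _root_.map_zero])

variable {g : LorentzMetric E M} (τ : CausalOrientation g) {α : M → ℝ}
  {R : ∀ x : M, TangentSpace 𝓘(ℝ, E) x → TangentSpace 𝓘(ℝ, E) x → ℝ}
  (hR : ∀ x u v, R x u v = lieMetric g φ x u v - α x * g.val x u v)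
  (hfut : IsFutureTensor g τ R)
include hR hfut

/-- Past-directed null vectors are covered by evenness of the quadratic form. -/
theorem isCausalFamily (x : M) : IsCausalFamily (hφ.pullBilin g x) (hφ.derivBilin g x) where
  lorentz := hφ.isLorentzian_pullBilin g x
  hasDerivAt s u v := (hφ.differentiable_pullMetric g x u v s).hasDerivAt
  nonneg s k hk := by
    by_cases hk0 : k = 0
    · simp [hk0]
    have hpk : push (φ s) x k ≠ 0 := fun h0 ↦ hk0 (hφ.push_injective s x (by rw [h0, _root_.map_zero]))
    have key (l : TangentSpace 𝓘(ℝ, E) (φ s x)) (hl : l ∈ futureNull g τ (φ s x)) :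
        0 ≤ lieMetric g φ (φ s x) l l := by
      have hl' := futureNull_subset_futureCausal g τ _ hl
      simpa [hR, hl.1] using hfut _ l hl' l hl'
    rw [hφ.derivBilin_apply]
    rcases g.futureNull_or_neg τ hpk hk with h | h
    · exact key _ h
    · simpa only [lieMetric_neg_neg] using key _ h

theorem isCausalSymmetry {s : ℝ} (hs : 0 ≤ s) : IsCausalSymmetry g τ (φ s) := by
  refine ⟨⟨hφ.diffeomorph s, rfl⟩, fun x u hu ↦ ?_⟩
  have hfam := hφ.isCausalFamily τ hR hfut x
  have hu0 : u ≠ 0 := by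
    rintro rfl
    simpa using hu.2
  have hcausal (t : ℝ) (ht : 0 ≤ t) : 0 ≤ g.val (φ t x) (push (φ t) x u) (push (φ t) x u) :=
    hfam.nonneg_of_le ht (u := u) (by
      change 0 ≤ pullMetric g (φ 0) x u u
      rw [hφ.pullMetric_zero]
      exact hu.1)
  refine ⟨hcausal s hs, ?_⟩
  by_contra! hle
  -- A change of time orientation would pass through a nonzero causal vector orthogonal to the
  -- timelike field.
  obtain ⟨t, ht, ht0⟩ := intermediate_value_Icc' hs (hφ.continuous_pairing g τ x u).continuousOn
    ⟨hle, (hφ.pairing_zero g τ x u ▸ hu.2.le)⟩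
  refine g.field_apply_ne_zero τ (fun h0 ↦ hu0 ?_) (hcausal t ht.1) ht0
  exact hφ.push_injective t x (by rw [h0, _root_.map_zero])

theorem principalNull_pullMetric_subset {s : ℝ} (hs : 0 < s) (x : M) :
    principalNull g τ (pullMetric g (φ s)) x ⊆ principalNull g τ R x := by
  rintro k ⟨hk, hks⟩
  have h0 : lieMetric g φ x k k = 0 :=
    (hφ.isCausalFamily τ hR hfut x).deriv_eq_zero_of_null hs
      ((hφ.pullMetric_zero g x k k).trans hk.1) hks
  exact ⟨hk, by rw [hR, h0, hk.1]; simp⟩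

theorem canonicalNull_subset (x : M) : canonicalNull g τ φ x ⊆ principalNull g τ R x :=
  fun _ hk ↦ hφ.principalNull_pullMetric_subset τ hR hfut one_pos x ⟨hk.1, hk.2 1⟩

omit hfut in
/-- Orthogonality to the principal null directions at `φ_s x`, expressed at `x`. -/
theorem forall_principalNull_iff (x : M) (s : ℝ) (v : TangentSpace 𝓘(ℝ, E) x) :
    (∀ k ∈ principalNull g τ R (φ s x), g.val (φ s x) k (push (φ s) x v) = 0) ↔
      ∀ k, hφ.pullBilin g x s k k = 0 → hφ.derivBilin g x s k k = 0 →
        hφ.pullBilin g x s k v = 0 := by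
  constructor
  · intro h k hk hDk
    by_cases hk0 : k = 0
    · simp [hk0]
    have hpk : push (φ s) x k ≠ 0 := fun h0 ↦ hk0 (hφ.push_injective s x (by rw [h0, _root_.map_zero]))
    rw [hφ.derivBilin_apply] at hDk
    have hk' : g.val (φ s x) (push (φ s) x k) (push (φ s) x k) = 0 := hk
    change g.val (φ s x) (push (φ s) x k) (push (φ s) x v) = 0
    rcases g.futureNull_or_neg τ hpk hk with hf | hf
    · exact h _ ⟨hf, by rw [hR, hDk, hk']; simp⟩
    · simpa using h _ ⟨hf, by rw [hR, lieMetric_neg_neg, hDk, hf.1]; simp⟩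
  · intro h k hk
    obtain ⟨k, rfl⟩ := hφ.push_surjective s x k
    refine h k hk.1.1 ?_
    have := hk.2
    rw [hR, hk.1.1, mul_zero, sub_zero] at this
    rw [hφ.derivBilin_apply, this]

theorem pullMetric_principalNull [FiniteDimensional ℝ E] {m : ℕ}
    (hm : ∀ x, Module.finrank ℝ (Submodule.span ℝ (principalNull g τ R x)) = m)
    {Ω : DiffForm E M m} (hΩ : IsTopFormOn g (principalNull g τ R) Ω) {ψ : M → ℝ}
    (hψ : ∀ x v, lieForm Ω φ x v = ψ x * Ω.val x v) {x : M} {k : TangentSpace 𝓘(ℝ, E) x}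
    (hk : k ∈ principalNull g τ R x) (s : ℝ) : pullMetric g (φ s) x k k = 0 := by
  have : ∀ y : M, FiniteDimensional ℝ (TangentSpace 𝓘(ℝ, E) y) :=
    fun _ ↦ inferInstanceAs (FiniteDimensional ℝ E)
  choose c b hc hbN hb hΩb using hΩ
  have hinj (y : M) : LinearMap.ker (g.form y) = ⊥ :=
    LinearMap.ker_eq_bot'.2 fun u hu ↦ (g.isLorentzian_form y).eq_zero_of_forall fun v ↦ by
      rw [hu]; rfl
  have hf (y : M) : LinearIndependent ℝ fun i ↦ g.form y (b y i) := (hb y).map' _ (hinj y)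
  -- The degree of `Ω` equals the dimension of the span, so its `m` factors already span all
  -- principal directions.
  have hspan (y : M) : Submodule.span ℝ (range (b y)) =
      Submodule.span ℝ (principalNull g τ R y) := by
    refine Submodule.eq_of_le_of_finrank_eq
      (Submodule.span_mono (range_subset_iff.2 (hbN y))) ?_
    rw [hm, finrank_span_eq_card (hb y), Fintype.card_fin]
  have horth (y : M) (v : TangentSpace 𝓘(ℝ, E) y) :
      (∀ i, g.form y (b y i) v = 0) ↔ ∀ k ∈ principalNull g τ R y, g.val y k v = 0 := by
    refine ⟨fun h k hk ↦ ?_, fun h i ↦ h _ (hbN y i)⟩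
    have hk' : k ∈ Submodule.span ℝ (range (b y)) := hspan y ▸ Submodule.subset_span hk
    have hle : Submodule.span ℝ (range (b y)) ≤ LinearMap.ker ((g.form y).flip v) :=
      Submodule.span_le.2 (range_subset_iff.2 h)
    exact hle hk'
  have hder (s : ℝ) (y : Fin m → TangentSpace 𝓘(ℝ, E) x) :
      HasDerivAt (fun s ↦ pullForm Ω (φ s) x y) (ψ (φ s x) * pullForm Ω (φ s) x y) s := by
    have := hφ.hasDerivAt_pullForm Ω x y s
    rwa [hψ] at this
  have hne (s : ℝ) : ∃ y, pullForm Ω (φ s) x y ≠ 0 := by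
    obtain ⟨y, hy⟩ := exists_det_ne_zero (hf (φ s x))
    choose y' hy' using fun i ↦ hφ.push_surjective s x (y i)
    refine ⟨y', ?_⟩
    unfold pullForm
    simp only [hy']
    rw [hΩb]
    exact mul_ne_zero (hc _) hy
  have hzero (s t : ℝ) (y : Fin m → TangentSpace 𝓘(ℝ, E) x) (h : pullForm Ω (φ s) x y = 0) :
      pullForm Ω (φ t) x y = 0 := zero_set_const hder hne y h t
  -- The kernel of `φ_s^* Ω` is the orthogonal complement of the principal directions at `φ s x`; by
  -- `hzero` it does not depend on `s`.
  have hker (s : ℝ) (v : TangentSpace 𝓘(ℝ, E) x) :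
      (∀ (y : Fin m → TangentSpace 𝓘(ℝ, E) x) (i : Fin m), y i = v →
        pullForm Ω (φ s) x y = 0) ↔
      ∀ k ∈ principalNull g τ R (φ s x), g.val (φ s x) k (push (φ s) x v) = 0 := by
    rw [← horth, ← forall_det_eq_zero_iff (hf (φ s x))]
    constructor
    · intro h y i hi
      choose y' hy' using fun i ↦ hφ.push_surjective s x (y i)
      have h1 := h y' i (hφ.push_injective s x (by rw [hy', hi]))
      unfold pullForm at h1
      simp only [hy'] at h1
      rw [hΩb] at h1
      exact (mul_eq_zero.1 h1).resolve_left (hc _)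
    · intro h y i hi
      unfold pullForm
      rw [hΩb]
      exact mul_eq_zero_of_right _ (h (fun j ↦ push (φ s) x (y j)) i (by rw [hi]))
  refine (hφ.isCausalFamily τ hR hfut x).null_of_orthogonal_const (a := 0)
    (K := {v | ∀ (y : Fin m → TangentSpace 𝓘(ℝ, E) x) (i : Fin m), y i = v →
      pullForm Ω (φ 0) x y = 0}) (fun s v ↦ ?_)
    ((hφ.pullMetric_zero g x k k).trans hk.1.1) ?_ s
  · rw [← hφ.forall_principalNull_iff τ hR, ← hker]
    exact ⟨fun h y i hi ↦ hzero 0 s y (h y i hi), fun h y i hi ↦ hzero s 0 y (h y i hi)⟩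
  · change lieMetric g φ x k k = 0
    have := hk.2
    rwa [hR, hk.1.1, mul_zero, sub_zero] at this

end IsGlobalFlow

end Metrics

end CausalSymm

end

/-! ### The main theorem. -/

theorem mainTheorem2 {E : Type*} [NormedAddCommGroup E] [NormedSpace ℝ E] [FiniteDimensional ℝ E]
    {M : Type*} [TopologicalSpace M] [T2Space M] [ChartedSpace E M] [IsManifold 𝓘(ℝ, E) ∞ M]
    (g : CausalSymm.LorentzMetric E M) (τ : CausalSymm.CausalOrientation g)
    (ξ : ∀ x : M, TangentSpace 𝓘(ℝ, E) x) (φ : ℝ → M → M)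
    (hφ : CausalSymm.IsGlobalFlow ξ φ)
    (α : M → ℝ)
    (R : ∀ x : M, TangentSpace 𝓘(ℝ, E) x → TangentSpace 𝓘(ℝ, E) x → ℝ)
    (hR : ∀ x u v, R x u v = CausalSymm.lieMetric g φ x u v - α x * g.val x u v)
    (hfut : CausalSymm.IsFutureTensor g τ R)
    (m : ℕ)
    (hm : ∀ x, Module.finrank ℝ (Submodule.span ℝ (CausalSymm.principalNull g τ R x)) = m) :
    ((∀ x, CausalSymm.principalNull g τ R x = ∅) →
      CausalSymm.IsCausalPreserving g τ ξ ∧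
      (∀ x, CausalSymm.canonicalNull g τ φ x = ∅) ∧
      ∀ s : ℝ, 0 < s → ∀ x,
        CausalSymm.principalNull g τ (CausalSymm.pullMetric g (φ s)) x = ∅) ∧
    ((∃ x, (CausalSymm.principalNull g τ R x).Nonempty) →
      ∀ Ω : CausalSymm.DiffForm E M m,
        CausalSymm.IsTopFormOn g (CausalSymm.principalNull g τ R) Ω →
        (∃ ψ : M → ℝ, ∀ x v, CausalSymm.lieForm Ω φ x v = ψ x * Ω.val x v) →
        CausalSymm.IsCausalPreserving g τ ξ ∧
        (∀ x, CausalSymm.canonicalNull g τ φ x = CausalSymm.principalNull g τ R x) ∧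
        ∀ s : ℝ, 0 < s → ∀ x,
          CausalSymm.principalNull g τ (CausalSymm.pullMetric g (φ s)) x =
            CausalSymm.principalNull g τ R x) := by

  have hpres : CausalSymm.IsCausalPreserving g τ ξ :=
    ⟨φ, hφ, fun s hs ↦ hφ.isCausalSymmetry τ hR hfut hs⟩
  have hcan := hφ.canonicalNull_subset τ hR hfut
  have hpull := fun (s : ℝ) (hs : 0 < s) ↦ hφ.principalNull_pullMetric_subset τ hR hfut hs
  refine ⟨fun hempty ↦ ⟨hpres, fun x ↦ subset_empty_iff.1 (hempty x ▸ hcan x),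
    fun s hs x ↦ subset_empty_iff.1 (hempty x ▸ hpull s hs x)⟩, fun _ Ω hΩ ⟨ψ, hψ⟩ ↦ ?_⟩
  -- Only this reverse inclusion uses `Ω`.
  have hnull := fun (x : M) k hk ↦
    hφ.pullMetric_principalNull τ hR hfut hm hΩ hψ (x := x) (k := k) hk
  exact ⟨hpres, fun x ↦ (hcan x).antisymm fun k hk ↦ ⟨hk.1, hnull x k hk⟩,
    fun s hs x ↦ (hpull s hs x).antisymm fun k hk ↦ ⟨hk.1, hnull x k hk s⟩⟩
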